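/- Let $X$ be an infinite-dimensional complex Banach space. A bounded linear operator $S:X\to X$ is called strictly singular if for every infinite-dimensional linear subspace $M\subset X$ the restriction $S|_M:M\to S(M)$ is not a linear homeomorphism. For a bounded linear operator $T:X\to X$ and $x\in X$, let $J_T(x)$ be the set of all $y\in X$ for which there exist a strictly increasing sequence $(k_n)$ of natural numbers and a sequence $(x_n)$ in $X$ such that $x_n\to x$ and $T^{k_n}x_n\to y$. The operator $T$ is called zero J-class if $J_T(0)=X$ and $J_T(x)\neq X$ for every $x\in X\setminus\{0\}$. Let $\lambda\in\mathbb{C}$ with $|\lambda|>1$, let $S:X\to X$ be strictly singular, and let $T=\lambda I+S$. Then $J_T(x)$ has empty interior for every non-zero $x\in X$. Moreover, $T$ is zero J-class if and only if its spectrum satisfies $\sigma(T)\subset\mathbb{C}\setminus\overline{\mathbb{D}}$, where $\overline{\mathbb{D}}=\{\mu\in\mathbb{C}:|\mu|\le 1\}$. -/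

import Mathlib

open Filter Topology

/-- The J-set of `x` under `T`: all `y` for which there are a strictly increasing sequence `k` of
natural numbers and a sequence `u n → x` with `T ^ (k n) (u n) → y`. -/
def JSet {𝕜 X : Type*} [NontriviallyNormedField 𝕜] [NormedAddCommGroup X] [NormedSpace 𝕜 X]
    (T : X →L[𝕜] X) (x : X) : Set X :=
  {y | ∃ (k : ℕ → ℕ) (u : ℕ → X), StrictMono k ∧ Tendsto u atTop (𝓝 x) ∧
    Tendsto (fun n => (T ^ k n) (u n)) atTop (𝓝 y)}

/-- `T` is zero J-class: the J-set of `0` is the whole space, and the J-set of every non-zero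
vector is a proper subset. -/
def IsZeroJClass {𝕜 X : Type*} [NontriviallyNormedField 𝕜] [NormedAddCommGroup X]
    [NormedSpace 𝕜 X] (T : X →L[𝕜] X) : Prop :=
  JSet T 0 = Set.univ ∧ ∀ x : X, x ≠ 0 → JSet T x ≠ Set.univ

/-- `S` is strictly singular: for no infinite-dimensional subspace `M` is the restriction
`S|_M : M → S(M)` a linear homeomorphism. -/
def IsStrictlySingular {𝕜 X Y : Type*} [NontriviallyNormedField 𝕜]
    [NormedAddCommGroup X] [NormedSpace 𝕜 X] [NormedAddCommGroup Y] [NormedSpace 𝕜 Y]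
    (S : X →L[𝕜] Y) : Prop :=
  ∀ M : Submodule 𝕜 X, ¬ FiniteDimensional 𝕜 M →
    ¬ ∃ e : M ≃L[𝕜] (M.map (S : X →ₗ[𝕜] Y)), ∀ m : M, (e m : Y) = S (m : X)

/-!
Everything is decided by whether `T` has a left eigenvector with eigenvalue in the closed unit disc.

If `f` is a nonzero continuous functional with `f ∘ T = μ f` and `‖μ‖ ≤ 1`, then along
`u n → x`, `T ^ k n (u n) → y` we have `f (T ^ k n (u n)) = μ ^ k n * f (u n)`, so `‖f y‖` is `0` or
`‖f x‖`. Each J-set, that of `0` included, lies in the preimage of a circle or of a point under the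
open map `f`, hence has empty interior (`interior_JSet_eq_empty_of_dual_eigenvector`). If instead
the spectrum of `T` misses the closed unit disc, then `T⁻¹` has spectral radius less than `1` and
its powers tend to `0`; so the J-set of `0` is everything and that of any nonzero vector is empty.

What remains is that every `μ` in the spectrum with `‖μ‖ ≤ 1` has such an `f`. As `‖z‖ > 1`, the
operator `T - μ = w + S` has `w = z - μ ≠ 0`, and the Fredholm alternative holds for it
(`IsStrictlySingular.exists_dual_of_not_isUnit`): its range is closed, and it is invertible once it
is surjective. The range is closed because `w + S` is bounded below on a closed subspace of finite
codimension (`IsStrictlySingular.exists_bounded_below`): otherwise Kato's construction yields an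
infinite-dimensional subspace on which `w + S` is small, so that `S` is bounded below there.

For the rest it suffices that `w + S` is a unit plus a finite-rank operator, since such operators
are injective if and only if they are surjective. This is shown for all `w + tS` at once: the set of
good `t` contains `0` and is open. It is closed because an operator bounded below on a
finite-codimensional subspace becomes bounded below or right invertible after a finite-rank change;
both properties persist under small perturbations with uniform constants, and force nearby
finite-rank perturbations of units to be units with controlled inverses.
-/

/-! ### Strictly singular operators -/

/-- If `f j (x j) = 1`, `‖f j‖ ≤ 1` and `f j` kills every later `x i`, then the coefficients of a
linear combination of the `x i` are controlled by its norm. The system is triangular, not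
biorthogonal, so the bound doubles at each step. -/
theorem norm_coeff_le_of_triangular {𝕜 X : Type*} [RCLike 𝕜] [NormedAddCommGroup X]
    [NormedSpace 𝕜 X] {x : ℕ → X} {f : ℕ → StrongDual 𝕜 X} (hf : ∀ j, ‖f j‖ ≤ 1)
    (hfx : ∀ j, f j (x j) = 1) (htri : ∀ j i, j < i → f j (x i) = 0) (hx : ∀ j, ‖x j‖ = 1)
    (s : Finset ℕ) (a : ℕ → 𝕜) :
    ∀ j ∈ s, ‖a j‖ ≤ 2 ^ j * ‖∑ i ∈ s, a i • x i‖ := by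
  intro j
  induction j using Nat.strong_induction_on with
  | _ j ih =>
    intro hj
    set v := ∑ i ∈ s, a i • x i with hv
    have h1 : f j v = a j + ∑ i ∈ s with i < j, a i * f j (x i) := by
      have : f j v = ∑ i ∈ s, a i * f j (x i) := by simp [hv, map_sum]
      rw [this, ← Finset.add_sum_erase s _ hj, hfx, mul_one]
      congr 1
      symm
      refine Finset.sum_subset_zero_on_sdiff ?_ ?_ fun _ _ => rfl
      · intro i hi
        rw [Finset.mem_filter] at hi
        exact Finset.mem_erase.2 ⟨hi.2.ne, hi.1⟩
      · intro i hi
        simp only [Finset.mem_sdiff, Finset.mem_erase, Finset.mem_filter, not_and, not_lt] at hi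
        rw [htri j i (lt_of_le_of_ne (hi.2 hi.1.2) (Ne.symm hi.1.1)), mul_zero]
    have hfj : ∀ y, ‖f j y‖ ≤ ‖y‖ := fun y => by
      simpa using (f j).le_of_opNorm_le (hf j) y
    have h2 : ‖∑ i ∈ s with i < j, a i * f j (x i)‖ ≤ ∑ i ∈ Finset.range j, 2 ^ i * ‖v‖ := by
      refine (norm_sum_le _ _).trans ?_
      refine (Finset.sum_le_sum (g := fun i => 2 ^ i * ‖v‖) ?_).trans ?_
      · intro i hi
        rw [Finset.mem_filter] at hi
        rw [norm_mul]
        have h3 : ‖f j (x i)‖ ≤ 1 := (hfj _).trans (hx i).le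
        calc ‖a i‖ * ‖f j (x i)‖ ≤ ‖a i‖ * 1 := by gcongr
          _ ≤ _ := by rw [mul_one]; exact ih i hi.2 hi.1
      · refine Finset.sum_le_sum_of_subset_of_nonneg ?_ fun i _ _ => by positivity
        intro i hi
        exact Finset.mem_range.2 (Finset.mem_filter.1 hi).2
    have h4 : a j = f j v - ∑ i ∈ s with i < j, a i * f j (x i) := by rw [h1]; ring
    have h5 : ∑ i ∈ Finset.range j, (2 : ℝ) ^ i * ‖v‖ = (2 ^ j - 1) * ‖v‖ := by
      rw [← Finset.sum_mul, geom_sum_eq (by norm_num)]; norm_num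
    calc ‖a j‖ ≤ ‖f j v‖ + ‖∑ i ∈ s with i < j, a i * f j (x i)‖ := by
          conv_lhs => rw [h4]
          exact norm_sub_le _ _
      _ ≤ ‖v‖ + (2 ^ j - 1) * ‖v‖ := add_le_add (hfj v) (h2.trans h5.le)
      _ = 2 ^ j * ‖v‖ := by ring

/-- If `A` is not bounded below on any intersection of finitely many kernels of continuous
functionals, then it has arbitrarily small norm on some infinite-dimensional subspace. -/
theorem exists_infiniteDimensional_norm_le {𝕜 X Y : Type*} [RCLike 𝕜] [NormedAddCommGroup X]
    [NormedSpace 𝕜 X] [NormedAddCommGroup Y] [NormedSpace 𝕜 Y] (A : X →L[𝕜] Y)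
    (hA : ∀ s : Finset (StrongDual 𝕜 X), ∀ c > 0, ∃ x, (∀ f ∈ s, f x = 0) ∧ ‖A x‖ < c * ‖x‖)
    {ε : ℝ} (hε : 0 < ε) :
    ∃ M : Submodule 𝕜 X, ¬ FiniteDimensional 𝕜 M ∧ ∀ x ∈ M, ‖A x‖ ≤ ε * ‖x‖ := by
  classical
  have hA' : ∀ s : Finset (StrongDual 𝕜 X), ∀ c > 0,
      ∃ x, ‖x‖ = 1 ∧ (∀ f ∈ s, f x = 0) ∧ ‖A x‖ ≤ c := by
    intro s c hc
    obtain ⟨x, hx, hAx⟩ := hA s c hc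
    have hx0 : x ≠ 0 := by rintro rfl; simp at hAx
    have hn : 0 < ‖x‖ := norm_pos_iff.2 hx0
    refine ⟨((‖x‖⁻¹ : ℝ) : 𝕜) • x, ?_, fun f hf => by simp [hx f hf], ?_⟩
    · rw [norm_smul, RCLike.norm_ofReal, abs_of_pos (by positivity), inv_mul_cancel₀ hn.ne']
    · rw [map_smul, norm_smul, RCLike.norm_ofReal, abs_of_pos (by positivity)]
      rw [inv_mul_le_iff₀ hn, mul_comm]
      exact hAx.le
  -- The third component records which bound on `‖A x‖` is to be met; it increases along the
  -- sequence, hence is at least the index.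
  obtain ⟨q, hqP, hqr⟩ := exists_seq_of_forall_finset_exists
    (α := X × StrongDual 𝕜 X × ℕ)
    (fun p => ‖p.1‖ = 1 ∧ ‖p.2.1‖ ≤ 1 ∧ p.2.1 p.1 = 1 ∧ ‖A p.1‖ ≤ ε / 2 * (1 / 4) ^ p.2.2)
    (fun p p' => p.2.1 p'.1 = 0 ∧ p.2.2 < p'.2.2) (by
      intro s _
      obtain ⟨x, hx, hxs, hAx⟩ := hA' (s.image fun p => p.2.1)
        (ε / 2 * (1 / 4) ^ (s.sup (fun p => p.2.2) + 1)) (by positivity)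
      obtain ⟨g, hg, hgx⟩ := exists_dual_vector'' 𝕜 x
      refine ⟨(x, g, s.sup (fun p => p.2.2) + 1), ⟨hx, hg, by simp [hgx, hx], hAx⟩, ?_⟩
      intro p hp
      exact ⟨hxs _ (Finset.mem_image_of_mem _ hp),
        Nat.lt_succ_of_le (Finset.le_sup (f := fun p : X × StrongDual 𝕜 X × ℕ => p.2.2) hp)⟩)
  have hmono : StrictMono fun n => (q n).2.2 := fun m n h => (hqr m n h).2
  have hAq : ∀ i, ‖A (q i).1‖ ≤ ε / 2 * (1 / 4) ^ i := fun i =>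
    (hqP i).2.2.2.trans (mul_le_mul_of_nonneg_left
      (pow_le_pow_of_le_one (by norm_num) (by norm_num) (hmono.id_le i)) (by positivity))
  have key := norm_coeff_le_of_triangular (𝕜 := 𝕜) (x := fun i => (q i).1)
    (f := fun i => (q i).2.1) (fun j => (hqP j).2.1) (fun j => (hqP j).2.2.1)
    (fun j i h => (hqr j i h).1) (fun j => (hqP j).1)
  refine ⟨Submodule.span 𝕜 (Set.range fun i => (q i).1), fun hfin => ?_, ?_⟩
  · have hli : LinearIndependent 𝕜 fun i => (q i).1 := by
      rw [linearIndependent_iff']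
      intro s a h0 j hj
      have := key s a j hj
      simp only [h0, norm_zero, mul_zero] at this
      exact norm_le_zero_iff.1 this
    exact Module.Finite.not_linearIndependent_of_infinite _ (linearIndependent_span hli)
  · intro x hx
    obtain ⟨a, rfl⟩ := Finsupp.mem_span_range_iff_exists_finsupp.1 hx
    have hk := key a.support a
    simp only [Finsupp.sum]
    set v := ∑ i ∈ a.support, a i • (q i).1
    have hAv : A v = ∑ i ∈ a.support, a i • A (q i).1 := by simp [v, map_sum]
    calc ‖A v‖ ≤ ∑ i ∈ a.support, ‖a i • A (q i).1‖ := by rw [hAv]; exact norm_sum_le _ _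
      _ ≤ ∑ i ∈ a.support, (1 / 2) ^ i * (ε / 2 * ‖v‖) := by
          refine Finset.sum_le_sum fun i hi => ?_
          rw [norm_smul]
          calc ‖a i‖ * ‖A (q i).1‖ ≤ (2 ^ i * ‖v‖) * (ε / 2 * (1 / 4) ^ i) :=
                mul_le_mul (hk i hi) (hAq i) (norm_nonneg _) (by positivity)
            _ = (2 * (1 / 4)) ^ i * (ε / 2 * ‖v‖) := by rw [mul_pow]; ring
            _ = _ := by norm_num
      _ ≤ 2 * (ε / 2 * ‖v‖) := by
          rw [← Finset.sum_mul]
          refine mul_le_mul_of_nonneg_right ?_ (by positivity)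
          refine (summable_geometric_two.sum_le_tsum _ fun i _ => by positivity).trans ?_
          rw [tsum_geometric_two]
      _ = ε * ‖v‖ := by ring

/-- A strictly singular operator is not bounded below on any infinite-dimensional subspace. -/
theorem IsStrictlySingular.not_bounded_below {𝕜 X Y : Type*} [NontriviallyNormedField 𝕜]
    [NormedAddCommGroup X] [NormedSpace 𝕜 X] [NormedAddCommGroup Y] [NormedSpace 𝕜 Y]
    {S : X →L[𝕜] Y} (hS : IsStrictlySingular S) {M : Submodule 𝕜 X}
    (hM : ¬ FiniteDimensional 𝕜 M) {c : ℝ} (hc : 0 < c) : ∃ x ∈ M, ‖S x‖ < c * ‖x‖ := by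
  by_contra! h
  refine hS M hM ?_
  let g : M →ₗ[𝕜] M.map (S : X →ₗ[𝕜] Y) := (S : X →ₗ[𝕜] Y).submoduleMap M
  have hginj : Function.Injective g := by
    rw [injective_iff_map_eq_zero]
    intro m hm
    have h0 : S (m : X) = 0 := congrArg Subtype.val hm
    have h1 := h m m.2
    rw [h0, norm_zero] at h1
    have : ‖(m : X)‖ ≤ 0 := nonpos_of_mul_nonpos_right h1 hc
    exact Subtype.ext (norm_le_zero_iff.1 this)
  let e := LinearEquiv.ofBijective g ⟨hginj, LinearMap.submoduleMap_surjective _ _⟩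
  have he : ∀ m, ((e m : M.map (S : X →ₗ[𝕜] Y)) : Y) = S (m : X) := fun m => rfl
  refine ⟨e.toContinuousLinearEquivOfBounds ‖S‖ c⁻¹ (fun m => ?_) fun y => ?_, fun m => he m⟩
  · rw [Submodule.coe_norm, he]
    exact S.le_opNorm _
  · obtain ⟨m, rfl⟩ := e.surjective y
    rw [e.symm_apply_apply, Submodule.coe_norm (e m), he, ← div_eq_inv_mul, le_div_iff₀' hc]
    exact h m m.2

/-- A nonzero multiple of the identity plus a multiple of a strictly singular operator is bounded
below on the common kernel of finitely many functionals. -/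
theorem IsStrictlySingular.exists_bounded_below {𝕜 X : Type*} [RCLike 𝕜] [NormedAddCommGroup X]
    [NormedSpace 𝕜 X] {S : X →L[𝕜] X} (hS : IsStrictlySingular S) {w : 𝕜} (hw : w ≠ 0) (t : 𝕜) :
    ∃ s : Finset (StrongDual 𝕜 X), ∃ c > 0, ∀ x, (∀ f ∈ s, f x = 0) →
      c * ‖x‖ ≤ ‖(w • (1 : X →L[𝕜] X) + t • S) x‖ := by
  by_contra! h
  have hwn : 0 < ‖w‖ := norm_pos_iff.2 hw
  obtain ⟨M, hM, hsmall⟩ := exists_infiniteDimensional_norm_le _ h (half_pos hwn)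
  obtain ⟨x, hxM, hx⟩ := hS.not_bounded_below hM (c := ‖w‖ / 2 / (‖t‖ + 1)) (by positivity)
  have h1 : ‖w‖ * ‖x‖ ≤ ‖w‖ / 2 * ‖x‖ + ‖t‖ * ‖S x‖ := by
    calc ‖w‖ * ‖x‖ = ‖(w • (1 : X →L[𝕜] X) + t • S) x - t • S x‖ := by simp [norm_smul]
      _ ≤ ‖(w • (1 : X →L[𝕜] X) + t • S) x‖ + ‖t • S x‖ := norm_sub_le _ _
      _ ≤ _ := by rw [norm_smul]; gcongr; exact hsmall x hxM
  have h2 : (‖t‖ + 1) * ‖S x‖ < ‖w‖ / 2 * ‖x‖ := by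
    calc (‖t‖ + 1) * ‖S x‖ < (‖t‖ + 1) * (‖w‖ / 2 / (‖t‖ + 1) * ‖x‖) := by gcongr
      _ = _ := by field_simp
  nlinarith [norm_nonneg (S x)]

/-! ### Finite-rank perturbations of units -/

/-- `A` becomes invertible after adding a finite-rank operator. On a Banach space these are the
Fredholm operators of index zero; this form makes the set of such operators visibly open. -/
def IsFiniteRankPerturbationOfUnit {𝕜 X : Type*} [NontriviallyNormedField 𝕜]
    [NormedAddCommGroup X] [NormedSpace 𝕜 X] (A : X →L[𝕜] X) : Prop :=
  ∃ F : X →L[𝕜] X, (F : X →ₗ[𝕜] X).HasFiniteRange ∧ IsUnit (A + F)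

theorem LinearMap.HasFiniteRange.injective_one_add_iff_surjective {K V : Type*} [Field K]
    [AddCommGroup V] [Module K V] {F : V →ₗ[K] V} (hF : F.HasFiniteRange) :
    Function.Injective (1 + F : V →ₗ[K] V) ↔ Function.Surjective (1 + F : V →ₗ[K] V) := by
  have : FiniteDimensional K F.range := Module.Finite.of_fg hF
  have hmaps : ∀ x ∈ F.range, (1 + F : V →ₗ[K] V) x ∈ F.range := fun x hx =>
    add_mem hx (LinearMap.mem_range_self F x)
  -- `1 + F` is determined up to bijection by its restriction to the finite-dimensional range.
  let g := (1 + F : V →ₗ[K] V).restrict hmaps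
  have hg : ∀ y : F.range, (g y : V) = y + F y := fun y => rfl
  have hgs : Function.Injective g ↔ Function.Surjective g := LinearMap.injective_iff_surjective
  constructor
  · intro hinj y
    have hginj : Function.Injective g := fun a b hab =>
      Subtype.ext (hinj (congrArg Subtype.val hab))
    obtain ⟨w, hw⟩ := hgs.1 hginj ⟨F y, LinearMap.mem_range_self F y⟩
    have hw' : (w : V) + F w = F y := by rw [← hg, hw]
    refine ⟨y - w, ?_⟩
    simp only [LinearMap.add_apply, Module.End.one_apply, map_sub]
    rw [← hw']; abel
  · intro hsurj
    have hgsurj : Function.Surjective g := by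
      intro v
      obtain ⟨x, hx⟩ := hsurj v
      simp only [LinearMap.add_apply, Module.End.one_apply] at hx
      have hxm : x ∈ F.range := by
        rw [eq_sub_of_add_eq hx]
        exact sub_mem v.2 (LinearMap.mem_range_self F x)
      exact ⟨⟨x, hxm⟩, Subtype.ext hx⟩
    rw [injective_iff_map_eq_zero]
    intro x hx
    have hx' : x + F x = 0 := hx
    have hxm : x ∈ F.range := by
      rw [eq_neg_of_add_eq_zero_left hx']
      exact neg_mem (LinearMap.mem_range_self F x)
    have : (⟨x, hxm⟩ : F.range) = 0 := hgs.2 hgsurj (Subtype.ext (by simp [hg, hx']))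
    exact congrArg Subtype.val this

namespace IsFiniteRankPerturbationOfUnit

variable {𝕜 X : Type*} [NontriviallyNormedField 𝕜] [NormedAddCommGroup X] [NormedSpace 𝕜 X]
  {A : X →L[𝕜] X}

theorem add_finiteRange (hA : IsFiniteRankPerturbationOfUnit A) {G : X →L[𝕜] X}
    (hG : (G : X →ₗ[𝕜] X).HasFiniteRange) : IsFiniteRankPerturbationOfUnit (A + G) := by
  obtain ⟨F, hF, hu⟩ := hA
  refine ⟨F - G, ?_, by simpa using hu⟩
  rw [ContinuousLinearMap.toLinearMap_sub]
  exact hF.sub hG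

theorem injective_iff_surjective (hA : IsFiniteRankPerturbationOfUnit A) :
    Function.Injective A ↔ Function.Surjective A := by
  obtain ⟨F, hF, u, hu⟩ := hA
  have hA : A = u * (1 + -((↑u⁻¹ : X →L[𝕜] X) * F)) := by
    rw [mul_add, mul_neg, ← mul_assoc, u.mul_inv, one_mul, mul_one, hu]; abel
  have hub : Function.Bijective (u : X →L[𝕜] X) :=
    (ContinuousLinearEquiv.ofUnit u).bijective
  have hK : (-(((↑u⁻¹ : X →L[𝕜] X) : X →ₗ[𝕜] X) ∘ₗ (F : X →ₗ[𝕜] X))).HasFiniteRange :=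
    (hF.comp_left _).neg
  have h := hK.injective_one_add_iff_surjective
  have hfun : (A : X → X) = (u : X →L[𝕜] X) ∘
      (1 + -(((↑u⁻¹ : X →L[𝕜] X) : X →ₗ[𝕜] X) ∘ₗ (F : X →ₗ[𝕜] X)) : X →ₗ[𝕜] X) := by
    conv_lhs => rw [hA]
    rfl
  rw [hfun, hub.injective.of_comp_iff, h]
  exact ⟨hub.surjective.comp, fun h' => h'.of_comp_left hub.injective⟩

theorem isOpen [CompleteSpace X] :
    IsOpen {A : X →L[𝕜] X | IsFiniteRankPerturbationOfUnit A} := by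
  rw [isOpen_iff_mem_nhds]
  rintro A ⟨F, hF, hu⟩
  have : ∀ᶠ B in 𝓝 A, IsUnit (B + F) :=
    (continuous_id.add continuous_const).continuousAt.eventually (Units.isOpen.mem_nhds hu)
  filter_upwards [this] with B hB using ⟨F, hF, hB⟩

variable [CompleteSpace X]

theorem isUnit_iff_injective (hA : IsFiniteRankPerturbationOfUnit A) :
    IsUnit A ↔ Function.Injective A := by
  rw [ContinuousLinearMap.isUnit_iff_bijective]
  exact ⟨fun h => h.1, fun h => ⟨h, hA.injective_iff_surjective.1 h⟩⟩

theorem isUnit_iff_surjective (hA : IsFiniteRankPerturbationOfUnit A) :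
    IsUnit A ↔ Function.Surjective A := by
  rw [hA.isUnit_iff_injective, hA.injective_iff_surjective]

/-- A bounded below operator that is a limit of finite-rank perturbations of units is a unit: the
nearby operators are injective, hence units, with uniformly bounded inverses. -/
theorem eventually_isUnit_of_bounded_below {c : ℝ} (hc : 0 < c) (hA : ∀ x, c * ‖x‖ ≤ ‖A x‖) :
    ∀ᶠ B in 𝓝 A, IsFiniteRankPerturbationOfUnit B → IsUnit A := by
  filter_upwards [Metric.ball_mem_nhds A (half_pos hc)] with B hBA hB
  rw [mem_ball_iff_norm] at hBA
  have hlow : ∀ x, c / 2 * ‖x‖ ≤ ‖B x‖ := by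
    intro x
    have h1 : ‖A x‖ ≤ ‖B x‖ + ‖(B - A) x‖ := by
      have : A x = B x - (B - A) x := by simp
      rw [this]; exact norm_sub_le _ _
    have h2 : ‖(B - A) x‖ ≤ c / 2 * ‖x‖ := (B - A).le_of_opNorm_le hBA.le x
    linarith [hA x]
  have hinj : Function.Injective B := by
    rw [injective_iff_map_eq_zero]
    intro x hx
    have := hlow x
    rw [hx, norm_zero] at this
    exact norm_le_zero_iff.1 (nonpos_of_mul_nonpos_right this (half_pos hc))
  obtain ⟨u, hu⟩ := hB.isUnit_iff_injective.2 hinj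
  rcases subsingleton_or_nontrivial X with hX | hX
  · exact isUnit_of_subsingleton _
  have hinv : ‖(↑u⁻¹ : X →L[𝕜] X)‖ ≤ (c / 2)⁻¹ := by
    refine ContinuousLinearMap.opNorm_le_bound _ (by positivity) fun y => ?_
    have h := hlow ((↑u⁻¹ : X →L[𝕜] X) y)
    have hy : B ((↑u⁻¹ : X →L[𝕜] X) y) = y := by
      rw [← hu, ← mul_apply_eq_comp, u.mul_inv]; rfl
    rw [hy] at h
    rw [← div_eq_inv_mul, le_div_iff₀' (half_pos hc)]
    exact h
  have hpos : 0 < ‖(↑u⁻¹ : X →L[𝕜] X)‖ := Units.norm_pos u⁻¹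
  refine (Units.ofNearby u A ?_).isUnit
  rw [hu, norm_sub_rev]
  exact hBA.trans_le ((le_inv_comm₀ (half_pos hc) hpos).2 hinv)

/-- A right invertible operator that is a limit of finite-rank perturbations of units is a unit. -/
theorem eventually_isUnit_of_mul_eq_one {R : X →L[𝕜] X} (hAR : A * R = 1) :
    ∀ᶠ B in 𝓝 A, IsFiniteRankPerturbationOfUnit B → IsUnit A := by
  have h1 : ∀ᶠ B in 𝓝 A, IsUnit (B * R) :=
    (continuous_id.mul continuous_const).continuousAt.eventually
      (Units.isOpen.mem_nhds (by simp [hAR]))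
  filter_upwards [h1] with B hBR hB
  have hsurj : Function.Surjective B := by
    have h : Function.Surjective (B ∘ R) :=
      (ContinuousLinearMap.isUnit_iff_bijective.1 hBR).surjective
    exact h.of_comp
  obtain ⟨v, rfl⟩ := hB.isUnit_iff_surjective.2 hsurj
  obtain ⟨u, rfl⟩ := (Units.isUnit_units_mul v R).1 hBR
  have : A = ↑u⁻¹ := by rw [← mul_one A, ← u.mul_inv, ← mul_assoc, hAR, one_mul]
  exact this ▸ u⁻¹.isUnit

end IsFiniteRankPerturbationOfUnit

universe u v in
theorem exists_linearMap_injective_or_surjective {K : Type*} {V : Type u} {W : Type v} [Field K]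
    [AddCommGroup V] [Module K V] [AddCommGroup W] [Module K W] :
    ∃ g : V →ₗ[K] W, Function.Injective g ∨ Function.Surjective g := by
  rcases le_total (Cardinal.lift.{v} (Module.rank K V)) (Cardinal.lift.{u} (Module.rank K W)) with h | h
  · obtain ⟨g, hg⟩ := lift_rank_le_iff_exists_linearMap.1 h
    exact ⟨g, Or.inl hg⟩
  · obtain ⟨i, hi⟩ := lift_rank_le_iff_exists_linearMap.1 h
    obtain ⟨g, hg⟩ := i.exists_leftInverse_of_injective (LinearMap.ker_eq_bot.2 hi)
    exact ⟨g, Or.inr fun w => ⟨i w, congr($hg w)⟩⟩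

/-! ### Operators bounded below on a subspace of finite codimension -/

section CofiniteBoundedBelow

variable {𝕜 X : Type*} [RCLike 𝕜] [NormedAddCommGroup X] [NormedSpace 𝕜 X] [CompleteSpace X]
  {A : X →L[𝕜] X} {N : Submodule 𝕜 X} {c : ℝ}

theorem isClosed_map_of_bounded_below (hN : IsClosed (N : Set X)) (hc : 0 < c)
    (hA : ∀ x ∈ N, c * ‖x‖ ≤ ‖A x‖) : IsClosed (N.map (A : X →ₗ[𝕜] X) : Set X) := by
  have : CompleteSpace N := hN.completeSpace_coe
  have hanti : AntilipschitzWith (Real.toNNReal c⁻¹) (A ∘L N.subtypeL) := by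
    refine ContinuousLinearMap.antilipschitz_of_bound _ fun x => ?_
    rw [Real.coe_toNNReal _ (by positivity), ← div_eq_inv_mul, le_div_iff₀' hc]
    exact hA x x.2
  have h := hanti.isClosed_range (A ∘L N.subtypeL).uniformContinuous
  convert h using 1
  ext y
  simp

/-- An operator bounded below on a closed subspace of finite codimension can be changed by a
finite-rank operator so as to become bounded below or right invertible. Which of the two occurs
depends on the sign of the index. -/
theorem exists_finiteRange_bounded_below_or_right_inverse (hN : IsClosed (N : Set X))
    [FiniteDimensional 𝕜 (X ⧸ N)] (hc : 0 < c) (hA : ∀ x ∈ N, c * ‖x‖ ≤ ‖A x‖) :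
    ∃ F : X →L[𝕜] X, (F : X →ₗ[𝕜] X).HasFiniteRange ∧
      ((∃ c' > 0, ∀ x, c' * ‖x‖ ≤ ‖(A + F) x‖) ∨ ∃ R : X →L[𝕜] X, (A + F) * R = 1) := by
  obtain ⟨E, hE⟩ := N.exists_isCompl
  have hEfin : FiniteDimensional 𝕜 E := (N.quotientEquivOfIsCompl E hE).finiteDimensional
  have htop := Submodule.IsCompl.isTopCompl_of_isClosed_of_finiteDimensional hE hN
  let P : X →L[𝕜] E := E.projectionOntoL N htop.symm
  have hPN : ∀ x, P x = 0 ↔ x ∈ N := fun x => Submodule.projectionOntoL_apply_eq_zero_iff htop.symm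
  have hPE : ∀ e : E, P e = e := fun e => Submodule.projectionOntoL_apply_left htop.symm e
  have hsub : ∀ x, x - P x ∈ N := fun x => by
    rw [← hPN, map_sub, hPE, sub_self]
  set W := N.map (A : X →ₗ[𝕜] X) with hW
  have hWcl : IsClosed (W : Set X) := isClosed_map_of_bounded_below hN hc hA
  obtain ⟨g, hg⟩ := exists_linearMap_injective_or_surjective (K := 𝕜) (V := E) (W := X ⧸ W)
  obtain ⟨r, hr⟩ := W.mkQ.exists_rightInverse_of_surjective W.range_mkQ
  have hr' : ∀ q, W.mkQ (r q) = q := fun q => congr($hr q)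
  -- `A + F` agrees with `A` on `N` and maps the complement `E` by a lift of `g`.
  let F : X →L[𝕜] X := (LinearMap.toContinuousLinearMap (r ∘ₗ g) - A ∘L E.subtypeL) ∘L P
  have hF : (F : X →ₗ[𝕜] X).HasFiniteRange :=
    LinearMap.HasFiniteRange.comp_right (v := ((LinearMap.toContinuousLinearMap (r ∘ₗ g) -
      A ∘L E.subtypeL : E →L[𝕜] X) : E →ₗ[𝕜] X)) LinearMap.HasFiniteRange.of_finite_dom _
  have hAF : ∀ x, (A + F) x = A (x - P x) + r (g (P x)) := by
    intro x; simp [F]; abel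
  have hmk : ∀ x, W.mkQ ((A + F) x) = g (P x) := by
    intro x
    have : W.mkQ (A (x - P x)) = 0 := by
      rw [Submodule.mkQ_apply, Submodule.Quotient.mk_eq_zero]
      exact Submodule.mem_map_of_mem (hsub x)
    rw [hAF, map_add, this, zero_add, hr']
  have hNinj : ∀ x ∈ N, (A + F) x = 0 → x = 0 := by
    intro x hx h0
    rw [hAF, (hPN x).2 hx] at h0
    have h1 := hA x hx
    have h2 : A x = 0 := by simpa using h0
    rw [h2, norm_zero] at h1
    exact norm_le_zero_iff.1 (nonpos_of_mul_nonpos_right h1 hc)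
  refine ⟨F, hF, ?_⟩
  rcases hg with hg | hg
  · left
    have hinj : Function.Injective (A + F) := by
      rw [injective_iff_map_eq_zero]
      intro x hx
      have hx' := hmk x
      rw [hx, map_zero] at hx'
      exact hNinj x ((hPN x).1 (hg (by rw [← hx', map_zero]))) hx
    have hcl : IsClosed (Set.range (A + F)) := by
      have : N.CoFG := ‹FiniteDimensional 𝕜 (X ⧸ N)›
      have hmap : N.map ((A + F : X →L[𝕜] X) : X →ₗ[𝕜] X) = W := by
        refine SetLike.coe_injective ?_
        simp only [hW, Submodule.map_coe]
        refine Set.image_congr fun x hx => ?_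
        change (A + F) x = A x
        rw [hAF, (hPN x).2 hx]
        simp
      exact LinearMap.isClosed_range_of_isClosed_map_of_finiteDimensional_quotient
        (f := ((A + F : X →L[𝕜] X) : X →ₗ[𝕜] X)) (s := N) (hmap ▸ hWcl)
    obtain ⟨K, hK⟩ := (A + F).antilipschitz_of_injective_of_isClosed_range hinj hcl
    refine ⟨((K : ℝ) + 1)⁻¹, by positivity, fun x => ?_⟩
    rw [← div_eq_inv_mul, div_le_iff₀' (by positivity)]
    have := ZeroHomClass.bound_of_antilipschitz (A + F) hK x
    nlinarith [norm_nonneg ((A + F) x)]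
  · right
    have hsurj : Function.Surjective (A + F) := by
      intro y
      obtain ⟨e, he⟩ := hg (W.mkQ y)
      have h1 : W.mkQ (y - (A + F) (e : X)) = 0 := by
        rw [map_sub, hmk, hPE, he, sub_self]
      rw [Submodule.mkQ_apply, Submodule.Quotient.mk_eq_zero] at h1
      obtain ⟨n, hn, hny⟩ := h1
      have h2 : (A + F) n = A n := by rw [hAF, (hPN n).2 hn]; simp
      refine ⟨n + e, ?_⟩
      rw [map_add, h2]
      have hny' : A n = y - (A + F) (e : X) := hny
      rw [hny']; abel
    have hker : FiniteDimensional 𝕜 (A + F).ker := by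
      refine FiniteDimensional.of_injective ((P : X →ₗ[𝕜] E) ∘ₗ (A + F).ker.subtype) ?_
      rw [injective_iff_map_eq_zero]
      intro x hx
      exact Subtype.ext (hNinj x ((hPN _).1 hx) x.2)
    obtain ⟨Z, hZcl, hZ⟩ := (Submodule.ClosedComplemented.of_finiteDimensional
      (A + F).ker).exists_isClosed_isCompl
    have : CompleteSpace Z := hZcl.completeSpace_coe
    let e : Z ≃L[𝕜] X := ContinuousLinearEquiv.ofBijective ((A + F) ∘L Z.subtypeL)
      (by
        rw [LinearMap.ker_eq_bot']
        intro x hx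
        exact Subtype.ext (Submodule.disjoint_def.1 hZ.disjoint x hx x.2))
      (by
        rw [LinearMap.range_eq_top]
        intro y
        obtain ⟨x, rfl⟩ := hsurj y
        obtain ⟨k, hk, z, hz, rfl⟩ := Submodule.mem_sup.1
          (hZ.sup_eq_top ▸ Submodule.mem_top : x ∈ (A + F).ker ⊔ Z)
        refine ⟨⟨z, hz⟩, ?_⟩
        have hk0 : (A + F) k = 0 := hk
        rw [map_add, hk0, zero_add]
        rfl)
    exact ⟨Z.subtypeL ∘L (e.symm : X →L[𝕜] Z), ContinuousLinearMap.ext fun y =>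
      e.apply_symm_apply y⟩

/-- Among the operators that are bounded below on `N`, the finite-rank perturbations of units form
a closed set: adding a finite-rank operator reduces to limits that are bounded below or right
invertible. -/
theorem eventually_isFiniteRankPerturbationOfUnit (hN : IsClosed (N : Set X))
    [FiniteDimensional 𝕜 (X ⧸ N)] (hc : 0 < c) (hA : ∀ x ∈ N, c * ‖x‖ ≤ ‖A x‖) :
    ∀ᶠ B in 𝓝 A, IsFiniteRankPerturbationOfUnit B → IsFiniteRankPerturbationOfUnit A := by
  obtain ⟨F, hF, h⟩ := exists_finiteRange_bounded_below_or_right_inverse hN hc hA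
  have hev : ∀ᶠ B in 𝓝 (A + F), IsFiniteRankPerturbationOfUnit B → IsUnit (A + F) := by
    rcases h with ⟨c', hc', h⟩ | ⟨R, hR⟩
    · exact IsFiniteRankPerturbationOfUnit.eventually_isUnit_of_bounded_below hc' h
    · exact IsFiniteRankPerturbationOfUnit.eventually_isUnit_of_mul_eq_one hR
  have hcont : Tendsto (fun B : X →L[𝕜] X => B + F) (𝓝 A) (𝓝 (A + F)) :=
    (continuous_id.add continuous_const).tendsto A
  filter_upwards [hcont.eventually hev] with B hB hBF
  exact ⟨F, hF, hB (hBF.add_finiteRange hF)⟩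

end CofiniteBoundedBelow

/-! ### Fredholm alternative for strictly singular operators -/

section StrictlySingular

variable {𝕜 X : Type*} [RCLike 𝕜] [NormedAddCommGroup X] [NormedSpace 𝕜 X]

theorem IsStrictlySingular.exists_cofinite_bounded_below {S : X →L[𝕜] X}
    (hS : IsStrictlySingular S) {w : 𝕜} (hw : w ≠ 0) (t : 𝕜) :
    ∃ N : Submodule 𝕜 X, IsClosed (N : Set X) ∧ FiniteDimensional 𝕜 (X ⧸ N) ∧ ∃ c > 0,
      ∀ x ∈ N, c * ‖x‖ ≤ ‖(w • (1 : X →L[𝕜] X) + t • S) x‖ := by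
  obtain ⟨s, c, hc, h⟩ := hS.exists_bounded_below hw t
  let Φ : X →L[𝕜] (s → 𝕜) := ContinuousLinearMap.pi fun f => (f : StrongDual 𝕜 X)
  refine ⟨Φ.ker, Φ.isClosed_ker, ?_, c, hc, fun x hx => h x fun f hf => ?_⟩
  · exact (Φ : X →ₗ[𝕜] (s → 𝕜)).quotKerEquivRange.symm.finiteDimensional
  · exact congrFun (show Φ x = 0 from hx) ⟨f, hf⟩

variable [CompleteSpace X] {S : X →L[𝕜] X}

/-- The set of `t` for which `w + tS` is a finite-rank perturbation of a unit is open, closed and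
contains `0`. -/
theorem IsStrictlySingular.isFiniteRankPerturbationOfUnit (hS : IsStrictlySingular S) {w : 𝕜}
    (hw : w ≠ 0) (t : 𝕜) :
    IsFiniteRankPerturbationOfUnit (w • (1 : X →L[𝕜] X) + t • S) := by
  set G := {t : 𝕜 | IsFiniteRankPerturbationOfUnit (w • (1 : X →L[𝕜] X) + t • S)} with hG
  have hcont : Continuous fun t : 𝕜 => w • (1 : X →L[𝕜] X) + t • S := by fun_prop
  have hopen : IsOpen G := IsFiniteRankPerturbationOfUnit.isOpen.preimage hcont
  have hclosed : IsClosed G := by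
    rw [isClosed_iff_frequently]
    intro t ht
    obtain ⟨N, hN, hfin, c, hc, h⟩ := hS.exists_cofinite_bounded_below hw t
    have hev := (hcont.tendsto t).eventually
      (eventually_isFiniteRankPerturbationOfUnit hN hc h)
    obtain ⟨t', h1, h2⟩ := (ht.and_eventually hev).exists
    exact h2 h1
  have h0 : (0 : 𝕜) ∈ G := by
    refine ⟨0, by simp, ?_⟩
    have h := (IsUnit.mk0 w hw).map (algebraMap 𝕜 (X →L[𝕜] X))
    simpa [Algebra.algebraMap_eq_smul_one] using h
  have : G = Set.univ := IsClopen.eq_univ ⟨hclosed, hopen⟩ ⟨0, h0⟩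
  exact (this ▸ Set.mem_univ t : t ∈ G)

/-- Fredholm alternative for strictly singular perturbations of nonzero scalars: a non-invertible
`w + S` has a nonzero functional vanishing on its range. -/
theorem IsStrictlySingular.exists_dual_of_not_isUnit (hS : IsStrictlySingular S) {w : 𝕜}
    (hw : w ≠ 0) (hu : ¬ IsUnit (w • (1 : X →L[𝕜] X) + S)) :
    ∃ f : StrongDual 𝕜 X, f ≠ 0 ∧ ∀ x, f (w • x + S x) = 0 := by
  set A := w • (1 : X →L[𝕜] X) + S with hA
  have hA1 : w • (1 : X →L[𝕜] X) + (1 : 𝕜) • S = A := by rw [one_smul]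
  have hfr : IsFiniteRankPerturbationOfUnit A := hA1 ▸ hS.isFiniteRankPerturbationOfUnit hw 1
  obtain ⟨N, hN, hfin, c, hc, h⟩ := hS.exists_cofinite_bounded_below hw 1
  rw [hA1] at h
  have hcl : IsClosed (((A : X →ₗ[𝕜] X).range : Submodule 𝕜 X) : Set X) := by
    have : N.CoFG := hfin
    exact LinearMap.isClosed_range_of_isClosed_map_of_finiteDimensional_quotient
      (isClosed_map_of_bounded_below hN hc h)
  rw [hfr.isUnit_iff_surjective] at hu
  obtain ⟨y, hy⟩ := not_forall.1 hu
  set R := (A : X →ₗ[𝕜] X).range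
  have hy0 : R.mkQ y ≠ 0 := by
    rw [Ne, Submodule.mkQ_apply, Submodule.Quotient.mk_eq_zero]
    exact hy
  obtain ⟨g, hg⟩ := SeparatingDual.exists_ne_zero (R := 𝕜) hy0
  refine ⟨g ∘L R.mkQL, fun h0 => hg ?_, fun x => ?_⟩
  · exact congr($h0 y)
  · have : R.mkQ (A x) = 0 := by
      rw [Submodule.mkQ_apply, Submodule.Quotient.mk_eq_zero]
      exact ⟨x, rfl⟩
    change g (R.mkQ (A x)) = 0
    rw [this, map_zero]

end StrictlySingular

/-! ### J-sets -/

section JSet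

/-- A left eigenvector `f` of `T` with eigenvalue in the closed unit disc confines each J-set to a
level set of `‖f ·‖`. -/
theorem interior_JSet_eq_empty_of_dual_eigenvector {𝕜 X : Type*} [RCLike 𝕜] [NormedAddCommGroup X]
    [NormedSpace 𝕜 X] {T : X →L[𝕜] X} {f : StrongDual 𝕜 X} (hf : f ≠ 0) {μ : 𝕜} (hμ : ‖μ‖ ≤ 1)
    (hfT : ∀ x, f (T x) = μ * f x) (x : X) : interior (JSet T x) = ∅ := by
  have hpow : ∀ (n : ℕ) (y : X), f ((T ^ n) y) = μ ^ n * f y := by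
    intro n
    induction n with
    | zero => simp
    | succ n ih =>
      intro y
      rw [pow_succ, mul_apply_eq_comp, ih, hfT, pow_succ, mul_assoc]
  obtain ⟨r, hr⟩ : ∃ r : ℝ, JSet T x ⊆ f ⁻¹' Metric.sphere 0 r := by
    rcases hμ.lt_or_eq with h | h
    · refine ⟨0, ?_⟩
      rintro y ⟨k, u, hk, hu, hy⟩
      have h1 : Tendsto (fun n => f ((T ^ k n) (u n))) atTop (𝓝 (f y)) :=
        (f.continuous.tendsto y).comp hy
      have h2 : Tendsto (fun n => f ((T ^ k n) (u n))) atTop (𝓝 (0 * f x)) := by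
        simp only [hpow]
        exact ((tendsto_pow_atTop_nhds_zero_of_norm_lt_one h).comp hk.tendsto_atTop).mul
          ((f.continuous.tendsto x).comp hu)
      simpa using tendsto_nhds_unique h1 h2
    · refine ⟨‖f x‖, ?_⟩
      rintro y ⟨k, u, hk, hu, hy⟩
      have h1 : Tendsto (fun n => ‖f ((T ^ k n) (u n))‖) atTop (𝓝 ‖f y‖) :=
        ((f.continuous.tendsto y).comp hy).norm
      have h2 : Tendsto (fun n => ‖f ((T ^ k n) (u n))‖) atTop (𝓝 ‖f x‖) := by
        simp only [hpow, norm_mul, norm_pow, h, one_pow, one_mul]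
        exact ((f.continuous.tendsto x).comp hu).norm
      simpa using tendsto_nhds_unique h1 h2
  have hopen : IsOpenMap f := f.isOpenMap_of_ne_zero hf
  rw [Set.eq_empty_iff_forall_notMem]
  intro y hy
  have hsub : f '' interior (JSet T x) ⊆ interior (Metric.sphere 0 r) :=
    interior_maximal (Set.image_subset_iff.2 (interior_subset.trans hr))
      (hopen _ isOpen_interior)
  have := hsub (Set.mem_image_of_mem f hy)
  rw [interior_sphere'] at this
  exact this

variable {𝕜 X : Type*} [NontriviallyNormedField 𝕜] [NormedAddCommGroup X] [NormedSpace 𝕜 X]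

theorem JSet_eq_empty_of_inv_pow_tendsto_zero {u : (X →L[𝕜] X)ˣ}
    (hu : Tendsto (fun n => (↑u⁻¹ : X →L[𝕜] X) ^ n) atTop (𝓝 0)) {x : X} (hx : x ≠ 0) :
    JSet (u : X →L[𝕜] X) x = ∅ := by
  rw [Set.eq_empty_iff_forall_notMem]
  rintro y ⟨k, v, hk, hv, hy⟩
  refine hx (tendsto_nhds_unique hv ?_)
  have h : Tendsto (fun n => ((↑u⁻¹ : X →L[𝕜] X) ^ k n) (((u : X →L[𝕜] X) ^ k n) (v n))) atTop
      (𝓝 ((0 : X →L[𝕜] X) y)) := 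
    (isBoundedBilinearMap_apply.continuous.tendsto ((0 : X →L[𝕜] X), y)).comp
      ((hu.comp hk.tendsto_atTop).prodMk_nhds hy)
  have he : ∀ n, ((↑u⁻¹ : X →L[𝕜] X) ^ k n) (((u : X →L[𝕜] X) ^ k n) (v n)) = v n := by
    intro n
    rw [← mul_apply_eq_comp, ← Units.val_pow_eq_pow_val, ← Units.val_pow_eq_pow_val,
      inv_pow, Units.inv_mul]
    rfl
  simpa only [he, zero_apply] using h

theorem JSet_zero_eq_univ_of_inv_pow_tendsto_zero {u : (X →L[𝕜] X)ˣ}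
    (hu : Tendsto (fun n => (↑u⁻¹ : X →L[𝕜] X) ^ n) atTop (𝓝 0)) :
    JSet (u : X →L[𝕜] X) 0 = Set.univ := by
  rw [Set.eq_univ_iff_forall]
  intro y
  refine ⟨id, fun n => ((↑u⁻¹ : X →L[𝕜] X) ^ n) y, strictMono_id, ?_, ?_⟩
  · simpa only [zero_apply] using! (isBoundedBilinearMap_apply.continuous.tendsto
      ((0 : X →L[𝕜] X), y)).comp (hu.prodMk_nhds tendsto_const_nhds)
  · have he : ∀ n : ℕ, ((u : X →L[𝕜] X) ^ n) (((↑u⁻¹ : X →L[𝕜] X) ^ n) y) = y := by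
      intro n
      rw [← mul_apply_eq_comp, ← Units.val_pow_eq_pow_val, ← Units.val_pow_eq_pow_val,
        inv_pow, Units.mul_inv]
      rfl
    simpa only [id_eq, he] using tendsto_const_nhds

end JSet

/-! ### Powers and the spectral radius -/

theorem tendsto_pow_zero_of_spectralRadius_lt_one {A : Type*} [NormedRing A] [NormedAlgebra ℂ A]
    [CompleteSpace A] {a : A} (ha : spectralRadius ℂ a < 1) :
    Tendsto (fun n => a ^ n) atTop (𝓝 0) := by
  obtain ⟨r, hr, hr1⟩ := ENNReal.lt_iff_exists_nnreal_btwn.1 ha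
  have hr1' : r < 1 := by exact_mod_cast hr1
  have hev := (spectrum.pow_nnnorm_pow_one_div_tendsto_nhds_spectralRadius a).eventually
    (gt_mem_nhds hr)
  refine squeeze_zero_norm' ?_ (tendsto_pow_atTop_nhds_zero_of_lt_one r.2 hr1')
  filter_upwards [hev, eventually_ge_atTop 1] with n hn hn1
  have hn0 : (n : ℝ) ≠ 0 := by positivity
  have h1 : ((‖a ^ n‖₊ : ENNReal) ^ (1 / n : ℝ)) ^ (n : ℝ) ≤ (r : ENNReal) ^ (n : ℝ) :=
    ENNReal.rpow_le_rpow hn.le (by positivity)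
  rw [← ENNReal.rpow_mul, one_div_mul_cancel hn0, ENNReal.rpow_one, ENNReal.rpow_natCast] at h1
  exact_mod_cast h1

theorem tendsto_inv_pow_zero_of_spectrum_subset {A : Type*} [NormedRing A] [NormedAlgebra ℂ A]
    [CompleteSpace A] {u : Aˣ} (hu : spectrum ℂ (u : A) ⊆ (Metric.closedBall (0 : ℂ) 1)ᶜ) :
    Tendsto (fun n => (↑u⁻¹ : A) ^ n) atTop (𝓝 0) := by
  nontriviality A
  refine tendsto_pow_zero_of_spectralRadius_lt_one ?_
  refine mod_cast spectrum.spectralRadius_lt_of_forall_lt (↑u⁻¹ : A) (r := 1) fun k hk => ?_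
  have hk' : k⁻¹ ∈ spectrum ℂ (u : A) := spectrum.inv₀_mem_iff.2 hk
  have h1 : 1 < ‖k⁻¹‖ := by simpa using hu hk'
  rw [norm_inv] at h1
  have : ‖k‖ < 1 := (one_lt_inv_iff₀.1 h1).2
  exact_mod_cast this

/-! ### Zero J-class operators -/

theorem theorem1p9 {X : Type*} [NormedAddCommGroup X] [NormedSpace ℂ X] [CompleteSpace X]
    (hX : ¬ FiniteDimensional ℂ X) (z : ℂ) (hz : 1 < ‖z‖)
    (S : X →L[ℂ] X) (hS : IsStrictlySingular S)
    (T : X →L[ℂ] X) (hT : T = z • ContinuousLinearMap.id ℂ X + S) :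
    (∀ x : X, x ≠ 0 → interior (JSet T x) = ∅) ∧
      (IsZeroJClass T ↔ spectrum ℂ T ⊆ (Metric.closedBall (0 : ℂ) 1)ᶜ) := by
  by_cases hσ : spectrum ℂ T ⊆ (Metric.closedBall (0 : ℂ) 1)ᶜ
  · have hunit : IsUnit T := by
      rw [← spectrum.zero_notMem_iff (R := ℂ)]
      exact fun h => hσ h (by simp)
    obtain ⟨u, rfl⟩ := hunit
    have hpow := tendsto_inv_pow_zero_of_spectrum_subset hσ
    have hempty : ∀ x : X, x ≠ 0 → JSet (u : X →L[ℂ] X) x = ∅ := fun x hx =>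
      JSet_eq_empty_of_inv_pow_tendsto_zero hpow hx
    refine ⟨fun x hx => by rw [hempty x hx, interior_empty], iff_of_true ⟨?_, fun x hx => ?_⟩ hσ⟩
    · exact JSet_zero_eq_univ_of_inv_pow_tendsto_zero hpow
    · rw [hempty x hx]
      exact Set.empty_ne_univ
  · -- Since `‖μ‖ ≤ 1 < ‖z‖`, the operator `T - μ = (z - μ) + S` has nonzero scalar part.
    obtain ⟨μ, hμ, hμ1⟩ := Set.not_subset.1 hσ
    have hμ1' : ‖μ‖ ≤ 1 := by simpa using hμ1
    have hw : z - μ ≠ 0 := by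
      rw [sub_ne_zero]
      rintro rfl
      exact absurd hz hμ1'.not_gt
    have hTμ : (z - μ) • (1 : X →L[ℂ] X) + S = -(algebraMap ℂ (X →L[ℂ] X) μ - T) := by
      rw [hT, Algebra.algebraMap_eq_smul_one, sub_smul]
      change _ = -(μ • (1 : X →L[ℂ] X) - (z • (1 : X →L[ℂ] X) + S))
      abel
    have hnu : ¬ IsUnit ((z - μ) • (1 : X →L[ℂ] X) + S) := by
      rw [hTμ, IsUnit.neg_iff]
      exact hμ
    obtain ⟨f, hf0, hf⟩ := hS.exists_dual_of_not_isUnit hw hnu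
    have hfT : ∀ x, f (T x) = μ * f x := by
      intro x
      have h := hf x
      simp only [map_add, map_smul, smul_eq_mul] at h
      simp only [hT, add_apply, smul_apply,
        ContinuousLinearMap.id_apply, map_add, map_smul, smul_eq_mul]
      linear_combination h
    have hint := interior_JSet_eq_empty_of_dual_eigenvector hf0 hμ1' hfT
    refine ⟨fun x _ => hint x, iff_of_false (fun h => ?_) hσ⟩
    have h0 := hint 0
    rw [h.1, interior_univ] at h0
    exact Set.empty_ne_univ h0.symm
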